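/- Simplicial complexes are finite and abstract, contain the empty face, and a face $\sigma$ has dimension $\#\sigma-1$; $V(X)$ is the vertex set of $X$, $\mathrm{lk}_X(\sigma)$ the link of $\sigma$, and $\mathrm{skel}_m(X)$ the subcomplex of all faces of dimension at most $m$. For a pure $d$-dimensional complex $X$, the boundary $\partial X$ is the subcomplex generated by the $(d-1)$-faces that lie in exactly one facet. For a field $\mathbb F$, an $\mathbb F$-homology $d$-sphere is a $d$-dimensional complex $X$ such that for every face $\sigma$ (including $\emptyset$) $\mathrm{lk}_X(\sigma)$ has the reduced $\mathbb F$-homology of the $(d-\#\sigma)$-sphere. An $\mathbb F$-homology $d$-ball is a $d$-dimensional complex $X$ whose boundary $\partial X$ is an $\mathbb F$-homology $(d-1)$-sphere and such that $\mathrm{lk}_X(\sigma)$ has vanishing reduced $\mathbb F$-homology for every face $\sigma\in\partial X$ (including $\emptyset$), and has the reduced $\mathbb F$-homology of the $(d-\#\sigma)$-sphere for every face $\sigma\in X\setminus\partial X$. Fix a class $\mathcal F$ of fields (for instance all fields, or a single field); a homology sphere (ball) is an $\mathbb F$-homology sphere (ball) for some $\mathbb F\in\mathcal F$. A homology $d$-manifold,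 possibly with boundary, is a $d$-dimensional complex each of whose vertex-links is a homology $(d-1)$-sphere or a homology $(d-1)$-ball. A homology $d$-ball $B$ is $k$-stacked if $\mathrm{skel}_{d-k-1}(B)=\mathrm{skel}_{d-k-1}(\partial B)$, and a homology $d$-sphere is $k$-stacked if it is the boundary of a $k$-stacked homology $(d+1)$-ball. Let $\mathcal K_k(d)$ (respectively $\overline{\mathcal K}_k(d)$) be the class of $d$-dimensional complexes all of whose vertex-links are $k$-stacked homology $(d-1)$-spheres (respectively $k$-stacked homology $(d-1)$-balls). **Theorem.** Let $k\ge 0$ and $d\ge 2k+2$. (a) For every $M\in\mathcal K_k(d)$, the complex $$\overline M:=\{\alpha\subseteq V(M)\;:\;\text{every subset of }\alpha\text{ of size}\le k+2\text{ is a face of }M\}$$ is a homology $(d+1)$-manifold with $\partial\overline M=M$ and $\mathrm{skel}_{d-k}(\overline M)=\mathrm{skel}_{d-k}(M)$, and it is the only homology $(d+1)$-manifold with these two properties. (b) The map $M\mapsto\overline M$ is a bijection from $\mathcal K_k(d)$ onto $\overline{\mathcal K}_k(d+1)$, and its inverse is the boundary map $N\mapsto\partial N$. (c) The same holds for the connected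 members: $M\mapsto\overline M$ is a bijection from the connected members of $\mathcal K_k(d)$ onto the connected members of $\overline{\mathcal K}_k(d+1)$, with inverse $N\mapsto\partial N$. -/

import Mathlib

namespace PreAbstractSimplicialComplex

/-!
A simplicial complex on vertices taken from `V` is a `PreAbstractSimplicialComplex V`: a family of
nonempty finite sets, closed under passing to nonempty subsets. The empty simplex is a face of every
complex by convention; it is not listed in `faces`, and `simplices` adds it.
-/

section Combinatorics

variable {V : Type*}

/-- All faces of `X`, the empty face included. -/
def simplices (X : PreAbstractSimplicialComplex V) : Set (Finset V) :=
  insert ∅ X.faces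

/-- The vertex set `V(X)`. -/
def vertices (X : PreAbstractSimplicialComplex V) : Set V :=
  {v | {v} ∈ X.faces}

/-- A facet is an inclusion-maximal face. -/
def IsFacet (X : PreAbstractSimplicialComplex V) (φ : Finset V) : Prop :=
  Maximal (fun σ => σ ∈ X.faces) φ

/-- `X` is a finite simplicial complex of dimension `d` (a face `σ` has dimension `#σ - 1`). -/
def IsFiniteOfDim (d : ℤ) (X : PreAbstractSimplicialComplex V) : Prop :=
  X.faces.Finite ∧ (∃ σ ∈ X.simplices, (σ.card : ℤ) = d + 1) ∧
    ∀ σ ∈ X.simplices, (σ.card : ℤ) ≤ d + 1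

/-- Any two vertices are joined by an edge path. -/
def IsConnected (X : PreAbstractSimplicialComplex V) [DecidableEq V] : Prop :=
  ∀ v ∈ X.vertices, ∀ w ∈ X.vertices,
    Relation.ReflTransGen (fun a b : V => ({a, b} : Finset V) ∈ X.faces) v w

/-- The `m`-skeleton: all faces of dimension at most `m`. -/
def skel (m : ℤ) (X : PreAbstractSimplicialComplex V) : PreAbstractSimplicialComplex V where
  faces := {σ | σ ∈ X.faces ∧ (σ.card : ℤ) ≤ m + 1}
  isRelLowerSet_faces := fun {σ} hσ =>
    ⟨(X.isRelLowerSet_faces hσ.1).1, fun _ hτ hne =>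
      ⟨(X.isRelLowerSet_faces hσ.1).2 hτ hne,
        le_trans (by exact_mod_cast Finset.card_le_card hτ) hσ.2⟩⟩

/-- The link of `σ`: all `τ` disjoint from `σ` such that `σ ∪ τ` is a face. -/
def link (X : PreAbstractSimplicialComplex V) [DecidableEq V] (σ : Finset V) :
    PreAbstractSimplicialComplex V where
  faces := {τ | τ.Nonempty ∧ Disjoint σ τ ∧ σ ∪ τ ∈ X.faces}
  isRelLowerSet_faces := fun {_} hτ =>
    ⟨hτ.1, fun _ hρ hne =>
      ⟨hne, Disjoint.mono_right hρ hτ.2.1,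
        (X.isRelLowerSet_faces hτ.2.2).2 (Finset.union_subset_union_right hρ)
          (hne.mono Finset.subset_union_right)⟩⟩

/-- The boundary `∂X`: the subcomplex generated by the faces `ρ` that have codimension one in a
facet `φ` and lie in no facet other than `φ`. -/
def bd (X : PreAbstractSimplicialComplex V) : PreAbstractSimplicialComplex V where
  faces := {τ | τ.Nonempty ∧ ∃ ρ φ : Finset V, τ ⊆ ρ ∧ ρ ⊆ φ ∧ X.IsFacet φ ∧
    φ.card = ρ.card + 1 ∧ ∀ ψ, X.IsFacet ψ → ρ ⊆ ψ → ψ = φ}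
  isRelLowerSet_faces := fun {_} hτ =>
    ⟨hτ.1, fun _ hsub hne =>
      ⟨hne, by
        obtain ⟨-, ρ, φ, h, h'⟩ := hτ
        exact ⟨ρ, φ, subset_trans hsub h, h'⟩⟩⟩

/-- `bar k X = {α ⊆ V(X) : every subset of α of size ≤ k + 2 is a face of X}`. -/
def bar (k : ℕ) (X : PreAbstractSimplicialComplex V) : PreAbstractSimplicialComplex V where
  faces := {α | α.Nonempty ∧ (α : Set V) ⊆ X.vertices ∧
    ∀ β ⊆ α, β.card ≤ k + 2 → β ∈ X.simplices}
  isRelLowerSet_faces := fun {_} hα =>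
    ⟨hα.1, fun _ hsub hne =>
      ⟨hne, subset_trans (Finset.coe_subset.2 hsub) hα.2.1,
        fun β hβ => hα.2.2 β (subset_trans hβ hsub)⟩⟩

end Combinatorics

section Homology

variable {V : Type*} [LinearOrder V] (F : Type*) [Field F]

/-- The simplicial boundary operator on finite formal combinations of finite subsets of `V`, each
subset being oriented by the linear order on `V`:
`{v₀ < ⋯ < vₘ} ↦ ∑ⱼ (-1)ʲ {v₀, …, vₘ} \ {vⱼ}`. It includes the augmentation `{v} ↦ ∅`. -/
noncomputable def boundaryMap : (Finset V →₀ F) →ₗ[F] (Finset V →₀ F) :=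
  Finsupp.linearCombination F fun σ : Finset V =>
    ∑ v ∈ σ, Finsupp.single (σ.erase v) ((-1 : F) ^ (σ.filter (· < v)).card)

/-- The `i`-chains of `X`, spanned by the faces of dimension `i` (for `i = -1`: the empty face). -/
noncomputable def chains (X : PreAbstractSimplicialComplex V) (i : ℤ) :
    Submodule F (Finset V →₀ F) :=
  Finsupp.supported F F {σ | σ ∈ X.simplices ∧ (σ.card : ℤ) = i + 1}

/-- The `i`-cycles of `X`. -/
noncomputable def cycles (X : PreAbstractSimplicialComplex V) (i : ℤ) :
    Submodule F (Finset V →₀ F) :=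
  X.chains F i ⊓ LinearMap.ker (boundaryMap F)

/-- The `i`-boundaries of `X`. -/
noncomputable def boundaries (X : PreAbstractSimplicialComplex V) (i : ℤ) :
    Submodule F (Finset V →₀ F) :=
  (X.chains F (i + 1)).map (boundaryMap F)

/-- The subquotient `Z / (Z ∩ B)` of a module. -/
abbrev Subquotient {R M : Type*} [Ring R] [AddCommGroup M] [Module R M] (Z B : Submodule R M) :
    Type _ :=
  Z ⧸ B.submoduleOf Z

/-- The reduced simplicial homology of `X` in degree `i`, with coefficients in `F`: the quotient of
the `i`-cycles by the `i`-boundaries. -/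
abbrev ReducedHomology (X : PreAbstractSimplicialComplex V) (i : ℤ) : Type _ :=
  Subquotient (X.cycles F i) (X.boundaries F i)

/-- `X` has the reduced `F`-homology of the `d`-sphere (for `d = -1`: of the complex `{∅}`). -/
def HasSphereHomology (d : ℤ) (X : PreAbstractSimplicialComplex V) : Prop :=
  Module.finrank F (X.ReducedHomology F d) = 1 ∧
    ∀ i : ℤ, i ≠ d → Subsingleton (X.ReducedHomology F i)

/-- `X` has vanishing reduced `F`-homology. -/
def HasTrivialHomology (X : PreAbstractSimplicialComplex V) : Prop :=
  ∀ i : ℤ, Subsingleton (X.ReducedHomology F i)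

/-- `X` is an `F`-homology `d`-sphere: it has dimension `d`, and the link of each face `σ` (the
empty face, with link `X`, included) has the homology of the sphere of dimension `d - #σ`. -/
def IsHomologySphereOver (d : ℤ) (X : PreAbstractSimplicialComplex V) : Prop :=
  X.IsFiniteOfDim d ∧
    ∀ σ ∈ X.simplices, HasSphereHomology F (d - σ.card) (X.link σ)

/-- `X` is an `F`-homology `d`-ball: it has dimension `d`, its boundary is an `F`-homology
`(d - 1)`-sphere, the link of each boundary face (the empty face, with link `X`, included) has
trivial homology, and the link of every other face `σ` has the homology of the sphere of dimension
`d - #σ`. -/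
def IsHomologyBallOver (d : ℤ) (X : PreAbstractSimplicialComplex V) : Prop :=
  X.IsFiniteOfDim d ∧ IsHomologySphereOver F (d - 1) X.bd ∧
    ∀ σ ∈ X.simplices,
      (σ ∈ X.bd.simplices → HasTrivialHomology F (X.link σ)) ∧
      (σ ∉ X.bd.simplices → HasSphereHomology F (d - σ.card) (X.link σ))

end Homology

section Classes

/-!
Throughout, `𝓕` is a class of fields, and a homology sphere or ball is one over some field in `𝓕`.
For `𝓕 = Set.univ` this is "homology sphere/ball over some field"; for a one-element class the
coefficient field is fixed once and for all.
-/

variable {V : Type*} [LinearOrder V] (𝓕 : Set (Σ F : Type*, Field F))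

/-- A homology `d`-sphere: an `F`-homology `d`-sphere for some field `F` in `𝓕`. -/
def IsHomologySphere (d : ℤ) (X : PreAbstractSimplicialComplex V) : Prop :=
  ∃ K ∈ 𝓕, @IsHomologySphereOver V _ K.1 K.2 d X

/-- A homology `d`-ball: an `F`-homology `d`-ball for some field `F` in `𝓕`. -/
def IsHomologyBall (d : ℤ) (X : PreAbstractSimplicialComplex V) : Prop :=
  ∃ K ∈ 𝓕, @IsHomologyBallOver V _ K.1 K.2 d X

/-- A homology `d`-manifold, possibly with boundary: a `d`-dimensional complex all whose
vertex-links are homology `(d - 1)`-spheres or homology `(d - 1)`-balls. -/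
def IsHomologyManifold (d : ℤ) (X : PreAbstractSimplicialComplex V) : Prop :=
  X.IsFiniteOfDim d ∧
    ∀ v ∈ X.vertices, IsHomologySphere 𝓕 (d - 1) (X.link {v}) ∨
      IsHomologyBall 𝓕 (d - 1) (X.link {v})

/-- A homology `d`-ball is `k`-stacked if all its faces of codimension at least `k + 1` lie in its
boundary. -/
def IsStackedBall (k : ℕ) (d : ℤ) (B : PreAbstractSimplicialComplex V) : Prop :=
  IsHomologyBall 𝓕 d B ∧ B.skel (d - k - 1) = B.bd.skel (d - k - 1)

/-- A homology `d`-sphere is `k`-stacked if it is the boundary of a `k`-stacked homology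
`(d + 1)`-ball. -/
def IsStackedSphere (k : ℕ) (d : ℤ) (S : PreAbstractSimplicialComplex V) : Prop :=
  IsHomologySphere 𝓕 d S ∧ ∃ B, IsStackedBall 𝓕 k (d + 1) B ∧ B.bd = S

/-- The `d`-dimensional complexes all whose vertex-links are `k`-stacked homology
`(d - 1)`-spheres. -/
def classK (V : Type*) [LinearOrder V] (𝓕 : Set (Σ F : Type*, Field F)) (k : ℕ) (d : ℤ) :
    Set (PreAbstractSimplicialComplex V) :=
  {M | M.IsFiniteOfDim d ∧ ∀ v ∈ M.vertices, IsStackedSphere 𝓕 k (d - 1) (M.link {v})}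

/-- The `d`-dimensional complexes all whose vertex-links are `k`-stacked homology
`(d - 1)`-balls. -/
def classKbar (V : Type*) [LinearOrder V] (𝓕 : Set (Σ F : Type*, Field F)) (k : ℕ) (d : ℤ) :
    Set (PreAbstractSimplicialComplex V) :=
  {N | N.IsFiniteOfDim d ∧ ∀ v ∈ N.vertices, IsStackedBall 𝓕 k (d - 1) (N.link {v})}

end Classes

end PreAbstractSimplicialComplex

/-! Everything rests on a bound for minimal nonfaces. In a `k`-stacked homology `D`-ball `B`, with
`D ≥ k`, all faces with at most `D - k` vertices lie in `∂B`, so their links are acyclic. Deleting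
vertices one at a time, a Mayer–Vietoris argument shows that no induced subcomplex of `B` has
homology in degree `≥ k` (`cycles_le_boundaries_del`). A minimal nonface with `m` vertices induces
the boundary of a simplex, which has homology in degree `m - 2`. Hence `m ≤ k + 1`, and `B` is
recovered from its faces with at most `k + 1` vertices (`IsStackedBall.mem_simplices`).

When `D = d ≥ 2k + 2`, those small faces already lie in `∂B`. So the stacked ball filling a vertex
link of `M` is forced, and it is the link of that vertex in `M.bar k` (`link_bar_eq`); adding the
vertex itself turns `k + 1` into the `k + 2` of `bar`. The criterion does not see the coefficient
field, so it may vary from vertex to vertex.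

Conversely, if the vertex links of `N` are `k`-stacked `d`-balls, then `N.bar k = N`, and `N` and
`∂N` share the skeleton on which `bar` depends (`bar_bd_eq`). Boundaries commute with vertex links
(`bd_link_vertex`), which reduces the remaining claims to links. -/

namespace PreAbstractSimplicialComplex

/-! ### The boundary operator and its splitting at a vertex -/

section ChainMaps

variable {V : Type*} [LinearOrder V] {F : Type*} [Field F]

theorem linearCombination_mem {ι N : Type*} [AddCommGroup N] [Module F N] (p : Submodule F N)
    (g : ι → N) (c : ι →₀ F) (h : ∀ σ ∈ c.support, g σ ∈ p) :
    Finsupp.linearCombination F g c ∈ p :=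
  Submodule.sum_mem _ fun σ hσ => p.smul_mem _ (h σ hσ)

theorem boundaryMap_single (σ : Finset V) (a : F) :
    boundaryMap F (Finsupp.single σ a) =
      a • ∑ v ∈ σ, Finsupp.single (σ.erase v) ((-1 : F) ^ (σ.filter (· < v)).card) := by
  simp [boundaryMap]

theorem card_filter_lt_of_lt {σ : Finset V} {v w : V} (hv : v ∈ σ) (h : v < w) :
    (σ.filter (· < w)).card = ((σ.erase v).filter (· < w)).card + 1 := by
  rw [Finset.filter_erase, Finset.card_erase_add_one]
  simp [hv, h]

theorem card_filter_lt_of_not_lt {σ : Finset V} {v w : V} (h : ¬ v < w) :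
    ((σ.erase v).filter (· < w)).card = (σ.filter (· < w)).card := by
  rw [Finset.filter_erase, Finset.erase_eq_of_notMem]
  simp [h]

theorem boundaryMap_boundaryMap (c : Finset V →₀ F) :
    boundaryMap F (boundaryMap F c) = 0 := by
  suffices h : (boundaryMap F (V := V)).comp (boundaryMap F) = 0 from LinearMap.congr_fun h c
  refine Finsupp.lhom_ext fun σ a => ?_
  rw [LinearMap.comp_apply, boundaryMap_single, map_smul, map_sum, LinearMap.zero_apply]
  convert smul_zero a
  simp only [boundaryMap_single, Finset.smul_sum]
  rw [Finset.sum_sigma']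
  refine Finset.sum_involution (fun p _ => ⟨p.2, p.1⟩) ?_ ?_ ?_ ?_
  · rintro ⟨v, w⟩ h
    simp only [Finset.mem_sigma, Finset.mem_erase] at h
    obtain ⟨hv, hne, hw⟩ := h
    simp only [Finsupp.smul_single, smul_eq_mul]
    rw [Finset.erase_right_comm (a := w), ← Finsupp.single_add]
    refine (congrArg _ ?_).trans (Finsupp.single_zero _)
    -- Removing the smaller vertex first shifts the position of the larger one by one, so the two
    -- orders of removal carry opposite signs.
    rcases lt_or_gt_of_ne hne with hlt | hlt
    · rw [card_filter_lt_of_not_lt hlt.not_gt, card_filter_lt_of_lt hw hlt]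
      ring
    · rw [card_filter_lt_of_not_lt (v := w) hlt.not_gt, card_filter_lt_of_lt hv hlt]
      ring
  · rintro ⟨v, w⟩ h - heq
    simp only [Finset.mem_sigma, Finset.mem_erase] at h
    simp only [Sigma.mk.injEq, heq_eq_eq] at heq
    exact h.2.1 heq.1
  · rintro ⟨v, w⟩ h
    simp only [Finset.mem_sigma, Finset.mem_erase] at h ⊢
    exact ⟨h.2.2, h.2.1.symm, h.1⟩
  · rintro ⟨v, w⟩ h
    rfl

theorem boundaryMap_single_ne_zero {σ : Finset V} (hσ : σ.Nonempty) :
    boundaryMap F (Finsupp.single σ 1) ≠ 0 := by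
  obtain ⟨v, hv⟩ := hσ
  intro h
  have h1 := DFunLike.congr_fun h (σ.erase v)
  rw [boundaryMap_single, one_smul, Finsupp.finsetSum_apply, Finset.sum_eq_single v] at h1
  · simp at h1
  · intro w hw hne
    rw [Finsupp.single_eq_of_ne]
    intro he
    exact hne (Finset.erase_injOn σ hw hv he.symm)
  · exact fun h => absurd hv h

/-- The component of a chain on the sets not containing `v`. -/
noncomputable def avoidMap (F : Type*) [Field F] (v : V) :
    (Finset V →₀ F) →ₗ[F] (Finset V →₀ F) :=
  Finsupp.linearCombination F fun σ => if v ∈ σ then 0 else Finsupp.single σ 1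

/-- The part of the boundary operator that removes the vertex `v`. -/
noncomputable def contractMap (F : Type*) [Field F] (v : V) :
    (Finset V →₀ F) →ₗ[F] (Finset V →₀ F) :=
  Finsupp.linearCombination F fun σ =>
    if v ∈ σ then Finsupp.single (σ.erase v) ((-1 : F) ^ (σ.filter (· < v)).card) else 0

/-- A term of the boundary avoids `v` either because the original set did, or because `v` is the
vertex removed. This is the chain-level form of the Mayer–Vietoris connecting map. -/
theorem avoidMap_boundaryMap (v : V) (c : Finset V →₀ F) :
    avoidMap F v (boundaryMap F c) = boundaryMap F (avoidMap F v c) + contractMap F v c := by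
  suffices h : (avoidMap F v).comp (boundaryMap F) =
      (boundaryMap F).comp (avoidMap F v) + contractMap F v from LinearMap.congr_fun h c
  refine Finsupp.lhom_ext fun σ a => ?_
  simp only [LinearMap.comp_apply, LinearMap.add_apply, boundaryMap_single, map_smul, map_sum]
  simp only [avoidMap, contractMap, Finsupp.linearCombination_single]
  by_cases hv : v ∈ σ
  · simp only [hv, if_true, smul_zero, map_zero, zero_add]
    congr 1
    rw [Finset.sum_eq_single v]
    · simp
    · intro w _ hne
      rw [if_pos (Finset.mem_erase.2 ⟨hne.symm, hv⟩), smul_zero]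
    · exact fun h => absurd hv h
  · simp only [hv, if_false, smul_zero, add_zero, map_smul, boundaryMap_single, one_smul]
    congr 1
    refine Finset.sum_congr rfl fun w _ => ?_
    simp [hv]

theorem avoidMap_eq_self {v : V} {c : Finset V →₀ F} (h : ∀ σ ∈ c.support, v ∉ σ) :
    avoidMap F v c = c := by
  rw [avoidMap, Finsupp.linearCombination_apply]
  conv_rhs => rw [← Finsupp.sum_single c]
  refine Finset.sum_congr rfl fun σ hσ => ?_
  simp [h σ hσ]

end ChainMaps

/-! ### Faces, links and deletions -/

section Links

variable {V : Type*}

theorem mem_simplices {X : PreAbstractSimplicialComplex V} {σ : Finset V} :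
    σ ∈ X.simplices ↔ σ = ∅ ∨ σ ∈ X.faces := Iff.rfl

theorem empty_mem_simplices (X : PreAbstractSimplicialComplex V) : ∅ ∈ X.simplices := Or.inl rfl

theorem nonempty_of_mem_faces {X : PreAbstractSimplicialComplex V} {σ : Finset V}
    (h : σ ∈ X.faces) : σ.Nonempty := (X.isRelLowerSet_faces h).1

theorem mem_faces_of_subset {X : PreAbstractSimplicialComplex V} {σ τ : Finset V}
    (h : σ ∈ X.faces) (hτ : τ ⊆ σ) (hne : τ.Nonempty) : τ ∈ X.faces :=
  (X.isRelLowerSet_faces h).2 hτ hne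

theorem mem_faces_of_mem_simplices {X : PreAbstractSimplicialComplex V} {σ : Finset V}
    (h : σ ∈ X.simplices) (hne : σ.Nonempty) : σ ∈ X.faces :=
  h.resolve_left hne.ne_empty

theorem mem_simplices_of_subset {X : PreAbstractSimplicialComplex V} {σ τ : Finset V}
    (h : σ ∈ X.simplices) (hτ : τ ⊆ σ) : τ ∈ X.simplices := by
  rcases τ.eq_empty_or_nonempty with rfl | hne
  · exact X.empty_mem_simplices
  · exact Or.inr (mem_faces_of_subset (mem_faces_of_mem_simplices h (hne.mono hτ)) hτ hne)

theorem ext_simplices {X Y : PreAbstractSimplicialComplex V}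
    (h : ∀ σ : Finset V, σ ∈ X.simplices ↔ σ ∈ Y.simplices) : X = Y := by
  apply PreAbstractSimplicialComplex.ext
  ext σ
  constructor
  · exact fun hσ => mem_faces_of_mem_simplices ((h σ).1 (Or.inr hσ)) (nonempty_of_mem_faces hσ)
  · exact fun hσ => mem_faces_of_mem_simplices ((h σ).2 (Or.inr hσ)) (nonempty_of_mem_faces hσ)

theorem mem_bar_simplices {X : PreAbstractSimplicialComplex V} {k : ℕ} {α : Finset V} :
    α ∈ (X.bar k).simplices ↔ ∀ β ⊆ α, β.card ≤ k + 2 → β ∈ X.simplices := by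
  constructor
  · rintro (rfl | h) β hβ hc
    · rw [Finset.subset_empty.1 hβ]
      exact X.empty_mem_simplices
    · exact h.2.2 β hβ hc
  · intro h
    rcases α.eq_empty_or_nonempty with rfl | hne
    · exact empty_mem_simplices _
    · refine Or.inr ⟨hne, fun v hv => ?_, h⟩
      exact mem_faces_of_mem_simplices
        (h {v} (Finset.singleton_subset_iff.2 hv) (by simp)) (Finset.singleton_nonempty v)

/-- The faces of `X` disjoint from `W`. -/
def del (X : PreAbstractSimplicialComplex V) (W : Finset V) : PreAbstractSimplicialComplex V where
  faces := {σ | σ ∈ X.faces ∧ Disjoint σ W}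
  isRelLowerSet_faces := fun {_} hσ =>
    ⟨nonempty_of_mem_faces hσ.1, fun _ hτ hne =>
      ⟨mem_faces_of_subset hσ.1 hτ hne, Finset.disjoint_of_subset_left hτ hσ.2⟩⟩

theorem mem_del_simplices {X : PreAbstractSimplicialComplex V} {W σ : Finset V} :
    σ ∈ (X.del W).simplices ↔ σ ∈ X.simplices ∧ Disjoint σ W := by
  constructor
  · rintro (rfl | h)
    · exact ⟨X.empty_mem_simplices, by simp⟩
    · exact ⟨Or.inr h.1, h.2⟩
  · rintro ⟨rfl | h, h'⟩
    · exact empty_mem_simplices _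
    · exact Or.inr ⟨h, h'⟩

variable [DecidableEq V]

theorem mem_link_simplices {X : PreAbstractSimplicialComplex V} {σ τ : Finset V}
    (hσ : σ ∈ X.simplices) :
    τ ∈ (X.link σ).simplices ↔ Disjoint σ τ ∧ σ ∪ τ ∈ X.simplices := by
  constructor
  · rintro (rfl | h)
    · simpa using hσ
    · exact ⟨h.2.1, Or.inr h.2.2⟩
  · rintro ⟨h1, h2⟩
    rcases τ.eq_empty_or_nonempty with rfl | hne
    · exact empty_mem_simplices _
    · exact Or.inr ⟨hne, h1,
        mem_faces_of_mem_simplices h2 (hne.mono Finset.subset_union_right)⟩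

theorem mem_link_vertex_simplices {X : PreAbstractSimplicialComplex V} {v : V} {τ : Finset V}
    (hv : v ∈ X.vertices) :
    τ ∈ (X.link {v}).simplices ↔ v ∉ τ ∧ insert v τ ∈ X.faces := by
  rw [mem_link_simplices (Or.inr hv), Finset.disjoint_singleton_left, ← Finset.insert_eq]
  exact and_congr_right fun _ =>
    ⟨fun h => mem_faces_of_mem_simplices h (Finset.insert_nonempty _ _), Or.inr⟩

theorem link_empty (X : PreAbstractSimplicialComplex V) : X.link ∅ = X :=
  ext_simplices fun σ => by simp [mem_link_simplices X.empty_mem_simplices]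

theorem link_link_vertex {X : PreAbstractSimplicialComplex V} {v : V} {σ : Finset V}
    (hv : v ∈ X.vertices) (hσ : σ ∈ (X.link {v}).simplices) :
    (X.link {v}).link σ = X.link (insert v σ) := by
  have hσ' := (mem_link_vertex_simplices hv).1 hσ
  refine ext_simplices fun τ => ?_
  rw [mem_link_simplices hσ, mem_link_vertex_simplices hv, mem_link_simplices (Or.inr hσ'.2),
    Finset.disjoint_insert_left, Finset.insert_union, Finset.mem_union]
  constructor
  · rintro ⟨h1, h2, h3⟩
    exact ⟨⟨fun h => h2 (Or.inr h), h1⟩, Or.inr h3⟩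
  · rintro ⟨⟨h1, h2⟩, h3⟩
    exact ⟨h2, fun h => h.elim hσ'.1 h1,
      mem_faces_of_mem_simplices h3 (Finset.insert_nonempty _ _)⟩

end Links

/-! ### Chains of a subcomplex -/

section Chains

variable {V : Type*} {F : Type*} [Field F]

theorem mem_chains {X : PreAbstractSimplicialComplex V} {i : ℤ} {c : Finset V →₀ F} :
    c ∈ X.chains F i ↔ ∀ σ ∈ c.support, σ ∈ X.simplices ∧ (σ.card : ℤ) = i + 1 :=
  Iff.rfl

theorem single_mem_chains {X : PreAbstractSimplicialComplex V} {i : ℤ} {σ : Finset V}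
    (h : σ ∈ X.simplices) (hc : (σ.card : ℤ) = i + 1) (a : F) :
    Finsupp.single σ a ∈ X.chains F i :=
  Finsupp.single_mem_supported F a (show σ ∈ {σ | σ ∈ X.simplices ∧ (σ.card : ℤ) = i + 1} from
    ⟨h, hc⟩)

theorem eq_zero_of_mem_chains {X : PreAbstractSimplicialComplex V} {i : ℤ} {c : Finset V →₀ F}
    (hc : c ∈ X.chains F i) (h : ∀ σ ∈ X.simplices, (σ.card : ℤ) ≠ i + 1) : c = 0 := by
  rw [← Finsupp.support_eq_empty, Finset.eq_empty_iff_forall_notMem]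
  intro σ hσ
  exact h σ (mem_chains.1 hc σ hσ).1 (mem_chains.1 hc σ hσ).2

theorem chains_mono {X Y : PreAbstractSimplicialComplex V}
    (h : ∀ σ ∈ X.simplices, σ ∈ Y.simplices) (i : ℤ) : X.chains F i ≤ Y.chains F i :=
  fun _ hc => mem_chains.2 fun σ hσ =>
    ⟨h σ (mem_chains.1 hc σ hσ).1, (mem_chains.1 hc σ hσ).2⟩

end Chains

/-! ### Homology of induced subcomplexes and minimal nonfaces -/

section Acyclicity

variable {V : Type*} [LinearOrder V] {F : Type*} [Field F]

theorem subsingleton_reducedHomology_iff {X : PreAbstractSimplicialComplex V} {i : ℤ} :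
    Subsingleton (X.ReducedHomology F i) ↔ X.cycles F i ≤ X.boundaries F i := by
  exact Submodule.Quotient.subsingleton_iff.trans Submodule.submoduleOf_eq_top

/-- Deleting a vertex preserves the vanishing of homology in degree `i` if the link of that vertex
has no homology in degree `i`. -/
theorem cycles_le_boundaries_del_insert {X : PreAbstractSimplicialComplex V} {v : V}
    {W : Finset V} {i : ℤ} (hv : v ∈ X.vertices)
    (hX : (X.del W).cycles F i ≤ (X.del W).boundaries F i)
    (hL : ((X.link {v}).del W).cycles F i ≤ ((X.link {v}).del W).boundaries F i) :
    (X.del (insert v W)).cycles F i ≤ (X.del (insert v W)).boundaries F i := by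
  rintro z ⟨hz, hz0⟩
  have hsub : ∀ σ ∈ (X.del (insert v W)).simplices, σ ∈ (X.del W).simplices := by
    intro σ hσ
    rw [mem_del_simplices, Finset.disjoint_insert_right] at hσ
    exact mem_del_simplices.2 ⟨hσ.1, hσ.2.2⟩
  obtain ⟨c, hc, rfl⟩ := hX ⟨chains_mono hsub i hz, hz0⟩
  have hπ : avoidMap F v (boundaryMap F c) = boundaryMap F c := by
    refine avoidMap_eq_self fun σ hσ => ?_
    have := (mem_del_simplices.1 (mem_chains.1 hz σ hσ).1).2
    exact (Finset.disjoint_insert_right.1 this).1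
  -- The cycle avoids `v`, so it differs from the boundary of the `v`-free part of `c` by a cycle in
  -- the link of `v`.
  have hdecomp := avoidMap_boundaryMap v c
  rw [hπ] at hdecomp
  have hcyc : boundaryMap F (contractMap F v c) = 0 := by
    rw [← sub_eq_iff_eq_add'.2 hdecomp, map_sub, boundaryMap_boundaryMap,
      boundaryMap_boundaryMap, sub_zero]
  have hchain : contractMap F v c ∈ ((X.link {v}).del W).chains F i := by
    refine linearCombination_mem _ _ _ fun σ hσ => ?_
    obtain ⟨h1, h2⟩ := mem_chains.1 hc σ hσ
    rw [mem_del_simplices] at h1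
    split_ifs with hvσ
    · refine single_mem_chains ?_ ?_ _
      · rw [mem_del_simplices, mem_link_vertex_simplices hv, Finset.insert_erase hvσ]
        exact ⟨⟨Finset.notMem_erase v σ, mem_faces_of_mem_simplices h1.1 ⟨v, hvσ⟩⟩,
          Finset.disjoint_of_subset_left (Finset.erase_subset v σ) h1.2⟩
      · have := Finset.card_erase_add_one hvσ
        omega
    · exact Submodule.zero_mem _
  obtain ⟨f, hf, hfe⟩ := hL ⟨hchain, hcyc⟩
  -- Trade the part of `c` through `v` for the filling `f` inside the link, which avoids `v`.
  refine ⟨avoidMap F v c + f, Submodule.add_mem _ ?_ ?_, ?_⟩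
  · refine linearCombination_mem _ _ _ fun σ hσ => ?_
    obtain ⟨h1, h2⟩ := mem_chains.1 hc σ hσ
    rw [mem_del_simplices] at h1
    split_ifs with hvσ
    · exact Submodule.zero_mem _
    · refine single_mem_chains ?_ h2 _
      rw [mem_del_simplices, Finset.disjoint_insert_right]
      exact ⟨h1.1, hvσ, h1.2⟩
  · refine chains_mono (fun σ hσ => ?_) _ hf
    rw [mem_del_simplices, mem_link_vertex_simplices hv] at hσ
    rw [mem_del_simplices, Finset.disjoint_insert_right]
    exact ⟨mem_simplices_of_subset (Or.inr hσ.1.2) (Finset.subset_insert v σ), hσ.1.1, hσ.2⟩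
  · rw [map_add, hfe, ← hdecomp]

/-- If `X` has dimension at most `n + k` and the links of all its faces with at most `n` vertices
are acyclic, then no induced subcomplex of `X` has homology in degree `k` or above. -/
theorem cycles_le_boundaries_del (k n : ℕ) (X : PreAbstractSimplicialComplex V)
    (hdim : ∀ σ ∈ X.simplices, σ.card ≤ n + k + 1)
    (hac : ∀ σ ∈ X.simplices, σ.card ≤ n → HasTrivialHomology F (X.link σ))
    (W : Finset V) (i : ℤ) (hi : (k : ℤ) ≤ i) :
    (X.del W).cycles F i ≤ (X.del W).boundaries F i := by
  induction n generalizing X W with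
  | zero =>
    rintro z ⟨hz, hz0⟩
    have h := subsingleton_reducedHomology_iff.1 (hac ∅ X.empty_mem_simplices le_rfl i)
    rw [link_empty] at h
    obtain ⟨c, hc, rfl⟩ := h ⟨chains_mono (fun σ hσ => (mem_del_simplices.1 hσ).1) i hz, hz0⟩
    -- The filling `c` has degree above `k`, the bound on the dimension of `X`, so it vanishes.
    rw [eq_zero_of_mem_chains hc fun σ hσ => ?_, map_zero]
    · exact Submodule.zero_mem _
    · have := hdim σ hσ
      omega
  | succ n ih =>
    induction W using Finset.induction_on with
    | empty =>
      have h := subsingleton_reducedHomology_iff.1 (hac ∅ X.empty_mem_simplices (Nat.zero_le _) i)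
      rw [link_empty] at h
      have hX : X.del ∅ = X := ext_simplices fun σ => by simp [mem_del_simplices]
      rwa [hX]
    | insert v W _ ihW =>
      by_cases hv : v ∈ X.vertices
      · refine cycles_le_boundaries_del_insert hv ihW (ih _ (fun σ hσ => ?_) (fun σ hσ hc => ?_) W)
        · rw [mem_link_vertex_simplices hv] at hσ
          have := hdim _ (Or.inr hσ.2)
          rw [Finset.card_insert_of_notMem hσ.1] at this
          omega
        · rw [link_link_vertex hv hσ]
          rw [mem_link_vertex_simplices hv] at hσ
          refine hac _ (Or.inr hσ.2) ?_
          rw [Finset.card_insert_of_notMem hσ.1]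
          omega
      · have hX : X.del (insert v W) = X.del W := ext_simplices fun σ => by
          rw [mem_del_simplices, mem_del_simplices, Finset.disjoint_insert_right]
          refine and_congr_right fun hσ => and_iff_right fun hvσ => hv ?_
          exact mem_faces_of_subset (mem_faces_of_mem_simplices hσ ⟨v, hvσ⟩)
            (Finset.singleton_subset_iff.2 hvσ) (Finset.singleton_nonempty v)
        rwa [hX]

/-- Under the hypotheses of `cycles_le_boundaries_del`, the minimal nonfaces of `X` have at most
`k + 1` vertices. -/
theorem mem_simplices_of_forall_ssubset {k n : ℕ} {X : PreAbstractSimplicialComplex V}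
    (hfin : X.faces.Finite) (hdim : ∀ σ ∈ X.simplices, σ.card ≤ n + k + 1)
    (hac : ∀ σ ∈ X.simplices, σ.card ≤ n → HasTrivialHomology F (X.link σ))
    {α : Finset V} (hα : k + 2 ≤ α.card) (hsub : ∀ β ⊂ α, β ∈ X.simplices) :
    α ∈ X.simplices := by
  by_contra hmem
  -- Deleting all vertices outside `α` leaves the proper subsets of `α`.
  set W : Finset V := (hfin.toFinset.biUnion id) \ α with hW
  have hdel : ∀ σ : Finset V, σ ∈ (X.del W).simplices ↔ σ ∈ X.simplices ∧ σ ⊆ α := by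
    intro σ
    rw [mem_del_simplices]
    refine and_congr_right fun hσ => ⟨fun hd v hv => ?_, fun hs => ?_⟩
    · by_contra hvα
      refine Finset.disjoint_left.1 hd hv (Finset.mem_sdiff.2 ⟨?_, hvα⟩)
      exact Finset.mem_biUnion.2
        ⟨σ, hfin.mem_toFinset.2 (mem_faces_of_mem_simplices hσ ⟨v, hv⟩), hv⟩
    · exact Finset.disjoint_of_subset_left hs Finset.disjoint_sdiff
  have hz : boundaryMap F (Finsupp.single α (1 : F)) ∈
      (X.del W).cycles F ((α.card : ℤ) - 2) := by
    refine ⟨?_, boundaryMap_boundaryMap _⟩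
    rw [boundaryMap_single, one_smul]
    refine Submodule.sum_mem _ fun v hv => single_mem_chains ?_ ?_ _
    · exact (hdel _).2 ⟨hsub _ (Finset.erase_ssubset hv), Finset.erase_subset v α⟩
    · have := Finset.card_erase_add_one hv
      omega
  obtain ⟨c, hc, hcz⟩ := cycles_le_boundaries_del k n X hdim hac W _ (by omega) hz
  refine boundaryMap_single_ne_zero (F := F) (σ := α) (Finset.card_pos.1 (by omega)) ?_
  -- A filling of this cycle would be supported on sets of size `#α` inside `α`, that is, on `α`,
  -- which is not a face.
  rw [← hcz, eq_zero_of_mem_chains hc fun σ hσ hcard => hmem ?_, map_zero]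
  rw [hdel] at hσ
  rw [← Finset.eq_of_subset_of_card_le hσ.2 (by omega)]
  exact hσ.1

end Acyclicity

/-! ### Boundaries, skeleta and `bar` under passage to links -/

section Combinatorics

variable {V : Type*}

theorem mem_faces_of_mem_bd {X : PreAbstractSimplicialComplex V} {σ : Finset V}
    (h : σ ∈ X.bd.faces) : σ ∈ X.faces := by
  obtain ⟨hne, ρ, φ, hσρ, hρφ, hφ, -⟩ := h
  exact mem_faces_of_subset hφ.1 (hσρ.trans hρφ) hne

theorem mem_simplices_of_mem_bd {X : PreAbstractSimplicialComplex V} {σ : Finset V}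
    (h : σ ∈ X.bd.simplices) : σ ∈ X.simplices :=
  h.imp_right mem_faces_of_mem_bd

theorem skel_eq_iff {X Y : PreAbstractSimplicialComplex V} {m : ℤ} :
    X.skel m = Y.skel m ↔
      ∀ σ : Finset V, (σ.card : ℤ) ≤ m + 1 → (σ ∈ X.simplices ↔ σ ∈ Y.simplices) := by
  constructor
  · intro h σ hc
    have h1 : σ ∈ (X.skel m).faces ↔ σ ∈ (Y.skel m).faces := by rw [h]
    exact or_congr_right ⟨fun hσ => (h1.1 ⟨hσ, hc⟩).1, fun hσ => (h1.2 ⟨hσ, hc⟩).1⟩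
  · intro h
    refine ext_simplices fun σ => or_congr_right (and_congr_left fun hc => ?_)
    constructor
    · exact fun hσ => mem_faces_of_mem_simplices ((h σ hc).1 (Or.inr hσ))
        (nonempty_of_mem_faces hσ)
    · exact fun hσ => mem_faces_of_mem_simplices ((h σ hc).2 (Or.inr hσ))
        (nonempty_of_mem_faces hσ)

theorem bar_congr {X Y : PreAbstractSimplicialComplex V} {k : ℕ} {m : ℤ}
    (h : X.skel m = Y.skel m) (hm : (k : ℤ) + 1 ≤ m) : X.bar k = Y.bar k := by
  refine ext_simplices fun α => ?_
  rw [mem_bar_simplices, mem_bar_simplices]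
  refine forall₃_congr fun β _ hc => skel_eq_iff.1 h β ?_
  omega

theorem vertices_bar (X : PreAbstractSimplicialComplex V) (k : ℕ) :
    (X.bar k).vertices = X.vertices := by
  ext v
  refine ⟨fun h => h.2.1 (Finset.mem_singleton_self v), fun h => ?_⟩
  refine mem_faces_of_mem_simplices (mem_bar_simplices.2 fun β hβ _ => ?_)
    (Finset.singleton_nonempty v)
  exact mem_simplices_of_subset (Or.inr h) hβ

theorem mem_vertices_of_mem {X : PreAbstractSimplicialComplex V} {σ : Finset V} {v : V}
    (hσ : σ ∈ X.simplices) (hv : v ∈ σ) : v ∈ X.vertices :=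
  mem_faces_of_mem_simplices
    (mem_simplices_of_subset hσ (Finset.singleton_subset_iff.2 hv)) (Finset.singleton_nonempty v)

theorem finite_vertices {X : PreAbstractSimplicialComplex V} (h : X.faces.Finite) :
    X.vertices.Finite :=
  h.preimage Finset.singleton_injective.injOn

theorem finite_bar {X : PreAbstractSimplicialComplex V} (h : X.faces.Finite) (k : ℕ) :
    (X.bar k).faces.Finite := by
  refine ((finite_vertices h).toFinset.powerset.finite_toSet).subset fun α hα => ?_
  rw [Finset.mem_coe, Finset.mem_powerset]
  exact fun v hv => (finite_vertices h).mem_toFinset.2 (hα.2.1 hv)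

theorem exists_mem_faces_of_dim {X : PreAbstractSimplicialComplex V} {d : ℤ} (hd : 0 ≤ d)
    (h : X.IsFiniteOfDim d) : ∃ σ, σ ∈ X.faces := by
  obtain ⟨σ, hσ, hc⟩ := h.2.1
  exact ⟨σ, mem_faces_of_mem_simplices hσ (Finset.card_pos.1 (by omega))⟩

theorem nonempty_vertices {X : PreAbstractSimplicialComplex V} {d : ℤ} (hd : 0 ≤ d)
    (h : X.IsFiniteOfDim d) : X.vertices.Nonempty := by
  obtain ⟨σ, hσ⟩ := exists_mem_faces_of_dim hd h
  obtain ⟨v, hv⟩ := nonempty_of_mem_faces hσ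
  exact ⟨v, mem_vertices_of_mem (Or.inr hσ) hv⟩

variable [DecidableEq V]

theorem isConnected_congr {X Y : PreAbstractSimplicialComplex V} {m : ℤ}
    (h : X.skel m = Y.skel m) (hm : 1 ≤ m) : X.IsConnected ↔ Y.IsConnected := by
  have hf : ∀ σ : Finset V, σ.Nonempty → σ.card ≤ 2 → (σ ∈ X.faces ↔ σ ∈ Y.faces) := by
    intro σ hne hc
    have h1 := skel_eq_iff.1 h σ (by omega)
    exact ⟨fun hσ => mem_faces_of_mem_simplices (h1.1 (Or.inr hσ)) hne,
      fun hσ => mem_faces_of_mem_simplices (h1.2 (Or.inr hσ)) hne⟩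
  have hV : X.vertices = Y.vertices := by
    ext v
    exact hf _ (Finset.singleton_nonempty v) (by simp)
  have hE : (fun a b : V => ({a, b} : Finset V) ∈ X.faces) =
      fun a b : V => ({a, b} : Finset V) ∈ Y.faces := by
    funext a b
    exact propext (hf _ (Finset.insert_nonempty _ _) Finset.card_le_two)
  rw [IsConnected, IsConnected, hV, hE]

theorem mem_link_vertex_faces {X : PreAbstractSimplicialComplex V} {v : V} {τ : Finset V} :
    τ ∈ (X.link {v}).faces ↔ τ.Nonempty ∧ v ∉ τ ∧ insert v τ ∈ X.faces := by
  refine and_congr_right fun _ => ?_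
  rw [Finset.disjoint_singleton_left, ← Finset.insert_eq]

theorem mem_vertices_of_link {X : PreAbstractSimplicialComplex V} {v : V} {τ : Finset V}
    (h : τ ∈ (X.link {v}).faces) : v ∈ X.vertices :=
  mem_vertices_of_mem (Or.inr (mem_link_vertex_faces.1 h).2.2) (Finset.mem_insert_self v τ)

theorem isFacet_link_vertex {X : PreAbstractSimplicialComplex V} {v : V} {φ : Finset V}
    (hne : φ.Nonempty) (hv : v ∉ φ) :
    (X.link {v}).IsFacet φ ↔ X.IsFacet (insert v φ) := by
  constructor
  · intro h
    refine ⟨(mem_link_vertex_faces.1 h.1).2.2, fun ψ hψ hle => ?_⟩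
    have hvψ : v ∈ ψ := hle (Finset.mem_insert_self v φ)
    have hsub : φ ⊆ ψ.erase v :=
      Finset.subset_erase.2 ⟨(Finset.subset_insert v φ).trans hle, hv⟩
    have := h.2 (y := ψ.erase v) (mem_link_vertex_faces.2
      ⟨hne.mono hsub, Finset.notMem_erase v ψ, by rwa [Finset.insert_erase hvψ]⟩) hsub
    exact Finset.subset_insert_iff.2 this
  · intro h
    refine ⟨mem_link_vertex_faces.2 ⟨hne, hv, h.1⟩, fun ψ hψ hle => ?_⟩
    have hψ' := mem_link_vertex_faces.1 hψ
    have := h.2 (y := insert v ψ) hψ'.2.2 (Finset.insert_subset_insert v hle)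
    exact (Finset.insert_subset_insert_iff hψ'.2.1).1 this

/-- Inserting `v` matches the nonempty facets of the link with the facets of `X` through `v` other
than `{v}`, preserving inclusions and codimension. -/
theorem bd_link_vertex (X : PreAbstractSimplicialComplex V) (v : V) :
    (X.link {v}).bd = X.bd.link {v} := by
  apply PreAbstractSimplicialComplex.ext
  ext τ
  rw [mem_link_vertex_faces]
  constructor
  · rintro ⟨hne, ρ, φ, hτρ, hρφ, hφ, hc, hu⟩
    have hvφ := (mem_link_vertex_faces.1 hφ.1).2.1
    have hvρ : v ∉ ρ := fun h => hvφ (hρφ h)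
    have hneφ : φ.Nonempty := hne.mono (hτρ.trans hρφ)
    refine ⟨hne, fun h => hvρ (hτρ h), Finset.insert_nonempty _ _, insert v ρ, insert v φ,
      Finset.insert_subset_insert v hτρ, Finset.insert_subset_insert v hρφ,
      (isFacet_link_vertex hneφ hvφ).1 hφ, ?_, fun ψ hψ hsub => ?_⟩
    · rw [Finset.card_insert_of_notMem hvφ, Finset.card_insert_of_notMem hvρ, hc]
    · have hvψ : v ∈ ψ := hsub (Finset.mem_insert_self v ρ)
      have hsub' : ρ ⊆ ψ.erase v :=
        Finset.subset_erase.2 ⟨(Finset.subset_insert v ρ).trans hsub, hvρ⟩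
      rw [← Finset.insert_erase hvψ] at hψ ⊢
      rw [hu _ ((isFacet_link_vertex (hne.mono (hτρ.trans hsub'))
        (Finset.notMem_erase v ψ)).2 hψ) hsub']
  · rintro ⟨hne, hvτ, -, ρ, φ, hτρ, hρφ, hφ, hc, hu⟩
    have hvρ : v ∈ ρ := hτρ (Finset.mem_insert_self v τ)
    have hvφ : v ∈ φ := hρφ hvρ
    have hτ' : τ ⊆ ρ.erase v :=
      Finset.subset_erase.2 ⟨(Finset.subset_insert v τ).trans hτρ, hvτ⟩
    have hρ' : ρ.erase v ⊆ φ.erase v := Finset.erase_subset_erase v hρφ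
    refine ⟨hne, ρ.erase v, φ.erase v, hτ', hρ', ?_, ?_, fun ψ hψ hsub => ?_⟩
    · rw [isFacet_link_vertex (hne.mono (hτ'.trans hρ')) (Finset.notMem_erase v φ),
        Finset.insert_erase hvφ]
      exact hφ
    · have h1 := Finset.card_erase_add_one hvρ
      have h2 := Finset.card_erase_add_one hvφ
      omega
    · have hψ' := mem_link_vertex_faces.1 hψ.1
      rw [← hu (insert v ψ) ((isFacet_link_vertex hψ'.1 hψ'.2.1).1 hψ)
        (Finset.subset_insert_iff.2 hsub), Finset.erase_insert hψ'.2.1]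

theorem isFiniteOfDim_of_link {X : PreAbstractSimplicialComplex V} {d : ℤ}
    (hfin : X.faces.Finite) (hne : X.vertices.Nonempty)
    (h : ∀ v ∈ X.vertices, (X.link {v}).IsFiniteOfDim (d - 1)) : X.IsFiniteOfDim d := by
  obtain ⟨v, hv⟩ := hne
  refine ⟨hfin, ?_, fun σ hσ => ?_⟩
  · obtain ⟨σ, hσ, hc⟩ := (h v hv).2.1
    rw [mem_link_vertex_simplices hv] at hσ
    refine ⟨_, Or.inr hσ.2, ?_⟩
    rw [Finset.card_insert_of_notMem hσ.1]
    push_cast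
    omega
  · rcases σ.eq_empty_or_nonempty with rfl | ⟨w, hw⟩
    · have := (h v hv).2.2 ∅ (empty_mem_simplices _)
      simp only [Finset.card_empty] at this ⊢
      omega
    · have hwX := mem_vertices_of_mem hσ hw
      have := (h w hwX).2.2 (σ.erase w) ((mem_link_vertex_simplices hwX).2
        ⟨Finset.notMem_erase w σ, by
          rw [Finset.insert_erase hw]; exact mem_faces_of_mem_simplices hσ ⟨w, hw⟩⟩)
      have := Finset.card_erase_add_one hw
      omega

theorem eq_of_link_vertex_eq {X Y : PreAbstractSimplicialComplex V}
    (hV : X.vertices = Y.vertices) (h : ∀ v ∈ X.vertices, X.link {v} = Y.link {v}) : X = Y := by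
  refine ext_simplices fun σ => ?_
  rcases σ.eq_empty_or_nonempty with rfl | ⟨v, hv⟩
  · simp [mem_simplices]
  have key : ∀ Z : PreAbstractSimplicialComplex V, v ∈ Z.vertices →
      (σ ∈ Z.simplices ↔ σ.erase v ∈ (Z.link {v}).simplices) := by
    intro Z hZ
    rw [mem_link_vertex_simplices hZ, Finset.insert_erase hv]
    exact ⟨fun h => ⟨Finset.notMem_erase v σ, mem_faces_of_mem_simplices h ⟨v, hv⟩⟩,
      fun h => Or.inr h.2⟩
  by_cases hvX : v ∈ X.vertices
  · rw [key X hvX, key Y (hV ▸ hvX), h v hvX]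
  · exact iff_of_false (fun hσ => hvX (mem_vertices_of_mem hσ hv))
      (fun hσ => hvX (hV ▸ mem_vertices_of_mem hσ hv))

end Combinatorics

/-! ### Homology spheres have no boundary -/

section Spheres

variable {V : Type*} [LinearOrder V] {F : Type*} [Field F]

theorem hasTrivialHomology_of_point {X : PreAbstractSimplicialComplex V} {w : V}
    (hX : ∀ σ : Finset V, σ ∈ X.simplices ↔ σ = ∅ ∨ σ = {w}) : HasTrivialHomology F X := by
  intro i
  refine subsingleton_reducedHomology_iff.2 ?_
  rintro z ⟨hz, hz0⟩
  have hsupp : ∀ τ : Finset V, (∀ σ ∈ X.simplices, (σ.card : ℤ) = i + 1 → σ = τ) →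
      z = Finsupp.single τ (z τ) := by
    intro τ h
    rw [← Finsupp.support_subset_singleton]
    intro σ hσ
    have := mem_chains.1 hz σ hσ
    exact Finset.mem_singleton.2 (h σ this.1 this.2)
  have hbd : ∀ a : F, boundaryMap F (Finsupp.single {w} a) = Finsupp.single ∅ a := by
    intro a
    rw [boundaryMap_single, Finset.sum_singleton]
    simp [Finset.filter_singleton]
  by_cases h1 : i = -1
  · have hz' := hsupp ∅ fun σ _ hc => Finset.card_eq_zero.1 (by omega)
    refine ⟨Finsupp.single {w} (z ∅), single_mem_chains ((hX _).2 (Or.inr rfl)) ?_ _, ?_⟩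
    · simp [h1]
    · rw [hbd, ← hz']
  have hz' := hsupp {w} fun σ hσ hc => by
    rcases (hX σ).1 hσ with rfl | h
    · simp only [Finset.card_empty] at hc
      omega
    · exact h
  have h0 : boundaryMap F z = 0 := hz0
  rw [hz', hbd, Finsupp.single_eq_zero] at h0
  rw [hz', h0, Finsupp.single_zero]
  exact Submodule.zero_mem _

theorem HasTrivialHomology.not_hasSphereHomology {X : PreAbstractSimplicialComplex V}
    (h : HasTrivialHomology F X) (d : ℤ) : ¬ HasSphereHomology F d X := by
  intro h'
  have := h d
  have h1 := h'.1
  rw [Module.finrank_zero_of_subsingleton] at h1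
  exact zero_ne_one h1

/-- A codimension-one face lying in a single facet has a single point as its link, which is acyclic,
whereas links in a sphere are not. -/
theorem IsHomologySphereOver.notMem_bd {X : PreAbstractSimplicialComplex V} {d : ℤ}
    (h : IsHomologySphereOver F d X) (τ : Finset V) : τ ∉ X.bd.faces := by
  rintro ⟨hne, ρ, φ, hτρ, hρφ, hφ, hc, hu⟩
  have hρ : ρ ∈ X.simplices := Or.inr (mem_faces_of_subset hφ.1 hρφ (hne.mono hτρ))
  obtain ⟨w, hw⟩ : ∃ w, φ \ ρ = {w} := by
    rw [← Finset.card_eq_one, Finset.card_sdiff_of_subset hρφ]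
    omega
  refine (hasTrivialHomology_of_point (w := w) fun σ => ?_).not_hasSphereHomology _ (h.2 ρ hρ)
  rw [mem_link_simplices hρ, ← Finset.subset_singleton_iff, ← hw]
  constructor
  · rintro ⟨hd, hσ⟩
    obtain ⟨ψ, hle, hψ⟩ := h.1.1.exists_le_maximal
      (mem_faces_of_mem_simplices hσ ((hne.mono hτρ).mono Finset.subset_union_left))
    have hψφ := hu ψ hψ (Finset.subset_union_left.trans hle)
    subst hψφ
    exact Finset.subset_sdiff.2 ⟨Finset.subset_union_right.trans hle, hd.symm⟩
  · intro hσ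
    rw [Finset.subset_sdiff] at hσ
    exact ⟨hσ.2.symm, mem_simplices_of_subset (Or.inr hφ.1) (Finset.union_subset hρφ hσ.1)⟩

end Spheres

/-! ### Stacked balls and the two classes -/

section Stacked

variable {V : Type*} [LinearOrder V] {𝓕 : Set (Σ F : Type*, Field F)} {k : ℕ}

theorem IsStackedBall.isFiniteOfDim {B : PreAbstractSimplicialComplex V} {D : ℤ}
    (h : IsStackedBall 𝓕 k D B) : B.IsFiniteOfDim D := by
  obtain ⟨⟨K, -, hB⟩, -⟩ := h
  exact hB.1

theorem IsStackedBall.isHomologySphere_bd {B : PreAbstractSimplicialComplex V} {D : ℤ}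
    (h : IsStackedBall 𝓕 k D B) : IsHomologySphere 𝓕 (D - 1) B.bd := by
  obtain ⟨⟨K, hK, hB⟩, -⟩ := h
  exact ⟨K, hK, hB.2.1⟩

theorem IsHomologySphere.isFiniteOfDim {X : PreAbstractSimplicialComplex V} {D : ℤ}
    (h : IsHomologySphere 𝓕 D X) : X.IsFiniteOfDim D := by
  obtain ⟨K, -, hX⟩ := h
  exact hX.1

theorem IsStackedBall.mem_bd {B : PreAbstractSimplicialComplex V} {D : ℤ}
    (h : IsStackedBall 𝓕 k D B) {σ : Finset V} (hσ : σ ∈ B.simplices)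
    (hc : (σ.card : ℤ) ≤ D - k) : σ ∈ B.bd.simplices :=
  (skel_eq_iff.1 h.2 σ (by omega)).1 hσ

/-- A `k`-stacked ball is determined by its faces with at most `k + 1` vertices. -/
theorem IsStackedBall.mem_simplices {B : PreAbstractSimplicialComplex V} {D : ℤ}
    (h : IsStackedBall 𝓕 k D B) (hD : (k : ℤ) ≤ D) (α : Finset V)
    (hα : ∀ β ⊆ α, β.card ≤ k + 1 → β ∈ B.simplices) : α ∈ B.simplices := by
  induction α using Finset.strongInduction with
  | H α ih =>
    by_cases hc : α.card ≤ k + 1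
    · exact hα α subset_rfl hc
    · have hmem := fun σ => h.mem_bd (σ := σ)
      obtain ⟨⟨⟨F, _⟩, -, hB⟩, -⟩ := h
      obtain ⟨n, hn⟩ := Int.eq_ofNat_of_zero_le (sub_nonneg.2 hD)
      -- Here `n = D - k`: stackedness puts faces with at most `n` vertices on the boundary, where
      -- links are acyclic.
      refine mem_simplices_of_forall_ssubset (F := F) (k := k) (n := n) hB.1.1 (fun σ hσ => ?_)
        (fun σ hσ hcard => (hB.2.2 σ hσ).1 (hmem σ hσ (by omega))) (by omega)
        (fun β hβ => ih β hβ fun γ hγ => hα γ (hγ.trans hβ.1))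
      have := hB.1.2.2 σ hσ
      omega

/-- The link of a vertex of `α` is determined by its faces with at most `k + 1` vertices; together
with that vertex these have at most `k + 2`. -/
theorem bar_eq_self {N : PreAbstractSimplicialComplex V} {D : ℤ} (hD : (k : ℤ) ≤ D)
    (h : ∀ v ∈ N.vertices, IsStackedBall 𝓕 k D (N.link {v})) : N.bar k = N := by
  refine ext_simplices fun α => ?_
  rw [mem_bar_simplices]
  refine ⟨fun hα => ?_, fun hα β hβ _ => mem_simplices_of_subset hα hβ⟩
  rcases α.eq_empty_or_nonempty with rfl | ⟨v, hv⟩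
  · exact N.empty_mem_simplices
  have hvN : v ∈ N.vertices := mem_faces_of_mem_simplices
    (hα {v} (Finset.singleton_subset_iff.2 hv) (by simp)) (Finset.singleton_nonempty v)
  have := (h v hvN).mem_simplices hD (α.erase v) fun β hβ hc => by
    rw [Finset.subset_erase] at hβ
    rw [mem_link_vertex_simplices hvN]
    refine ⟨hβ.2, mem_faces_of_mem_simplices (hα _ (Finset.insert_subset hv hβ.1) ?_)
      (Finset.insert_nonempty _ _)⟩
    rw [Finset.card_insert_of_notMem hβ.2]
    omega
  rw [mem_link_vertex_simplices hvN, Finset.insert_erase hv] at this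
  exact Or.inr this.2

/-- In a complex whose vertex links are `k`-stacked balls, all vertices are on the boundary. -/
theorem vertices_bd_eq {N : PreAbstractSimplicialComplex V} {D : ℤ} (hD : 1 ≤ D)
    (h : ∀ v ∈ N.vertices, IsStackedBall 𝓕 k D (N.link {v})) : N.bd.vertices = N.vertices := by
  ext v
  refine ⟨mem_faces_of_mem_bd, fun hv => ?_⟩
  obtain ⟨τ, hτ⟩ := exists_mem_faces_of_dim (by omega) (h v hv).isHomologySphere_bd.isFiniteOfDim
  rw [bd_link_vertex] at hτ
  exact mem_vertices_of_link hτ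

variable {d : ℕ}

theorem skel_eq_skel_bd {N : PreAbstractSimplicialComplex V} (hd : 2 * k + 2 ≤ d)
    (h : N ∈ classKbar V 𝓕 k (d + 1)) :
    N.skel ((d : ℤ) - k) = N.bd.skel ((d : ℤ) - k) := by
  refine skel_eq_iff.2 fun σ hc => ⟨fun hσ => ?_, mem_simplices_of_mem_bd⟩
  rcases σ.eq_empty_or_nonempty with rfl | ⟨v, hv⟩
  · exact empty_mem_simplices _
  have hvN := mem_vertices_of_mem hσ hv
  have hvbd : v ∈ N.bd.vertices := by rwa [vertices_bd_eq (by omega) h.2]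
  have hcard := Finset.card_erase_add_one hv
  have := (h.2 v hvN).mem_bd (σ := σ.erase v) ((mem_link_vertex_simplices hvN).2
    ⟨Finset.notMem_erase v σ, by
      rw [Finset.insert_erase hv]; exact mem_faces_of_mem_simplices hσ ⟨v, hv⟩⟩) (by omega)
  rw [bd_link_vertex, mem_link_vertex_simplices hvbd, Finset.insert_erase hv] at this
  exact Or.inr this.2

theorem bar_bd_eq {N : PreAbstractSimplicialComplex V} (hd : 2 * k + 2 ≤ d)
    (h : N ∈ classKbar V 𝓕 k (d + 1)) : N.bd.bar k = N := by
  rw [← bar_congr (skel_eq_skel_bd hd h) (by omega)]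
  exact bar_eq_self (by omega) h.2

theorem bd_mem_classK {N : PreAbstractSimplicialComplex V} (hd : 2 * k + 2 ≤ d)
    (h : N ∈ classKbar V 𝓕 k (d + 1)) : N.bd ∈ classK V 𝓕 k d := by
  have hV := vertices_bd_eq (by omega) h.2
  have hlink : ∀ v ∈ N.bd.vertices, IsStackedSphere 𝓕 k ((d : ℤ) - 1) (N.bd.link {v}) := by
    intro v hv
    have hB := h.2 v (hV ▸ hv)
    rw [← bd_link_vertex]
    refine ⟨?_, N.link {v}, ?_, rfl⟩
    · convert hB.isHomologySphere_bd using 1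
      ring
    · convert hB using 1
      ring
  refine ⟨isFiniteOfDim_of_link (h.1.1.subset fun σ => mem_faces_of_mem_bd) ?_
    fun v hv => (hlink v hv).1.isFiniteOfDim, hlink⟩
  rw [hV]
  exact nonempty_vertices (by omega) h.1

theorem link_bar_eq {M B : PreAbstractSimplicialComplex V} {v : V} (hd : 2 * k + 2 ≤ d)
    (hv : v ∈ M.vertices) (hB : IsStackedBall 𝓕 k d B) (hBM : B.bd = M.link {v}) :
    (M.bar k).link {v} = B := by
  -- This is where `d ≥ 2k + 2` is sharp: `k + 2 ≤ d - k` puts these faces of `B` on its boundary,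
  -- the link of `v`. Size `k + 2` is needed below for those `β` that do not contain `v`.
  have hmem : ∀ β ∈ B.simplices, β.card ≤ k + 2 → v ∉ β ∧ insert v β ∈ M.faces := by
    intro β hβ hc
    rw [← mem_link_vertex_simplices hv, ← hBM]
    exact hB.mem_bd hβ (by omega)
  refine ext_simplices fun τ => ?_
  rw [mem_link_vertex_simplices (by rwa [vertices_bar])]
  constructor
  · rintro ⟨hvτ, hτ⟩
    refine hB.mem_simplices (by omega) τ fun β hβ hc => mem_simplices_of_mem_bd ?_
    have hvβ : v ∉ β := fun h => hvτ (hβ h)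
    rw [hBM, mem_link_vertex_simplices hv]
    refine ⟨hvβ, mem_faces_of_mem_simplices (hτ.2.2 _ (Finset.insert_subset_insert v hβ) ?_)
      (Finset.insert_nonempty _ _)⟩
    rw [Finset.card_insert_of_notMem hvβ]
    omega
  · intro hτ
    refine ⟨fun hvτ => ?_, mem_faces_of_mem_simplices (mem_bar_simplices.2 fun β hβ hc => ?_)
      (Finset.insert_nonempty _ _)⟩
    -- If `v` were a vertex of `B`, it would be a vertex of `∂B` and so of its own link.
    · exact (hmem {v} (mem_simplices_of_subset hτ (Finset.singleton_subset_iff.2 hvτ))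
        (by simp)).1 (Finset.mem_singleton_self v)
    · have hβτ : β.erase v ∈ B.simplices :=
        mem_simplices_of_subset hτ (Finset.subset_insert_iff.1 hβ)
      have := (hmem _ hβτ ((Finset.card_le_card (Finset.erase_subset v β)).trans hc)).2
      exact mem_simplices_of_subset (Or.inr this) (Finset.insert_erase_subset v β)

theorem exists_ball_eq_link_bar {M : PreAbstractSimplicialComplex V} (hd : 2 * k + 2 ≤ d)
    (h : M ∈ classK V 𝓕 k d) {v : V} (hv : v ∈ M.vertices) :
    IsStackedBall 𝓕 k d ((M.bar k).link {v}) ∧ ((M.bar k).link {v}).bd = M.link {v} := by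
  obtain ⟨-, B, hB, hBM⟩ := h.2 v hv
  rw [sub_add_cancel] at hB
  rw [link_bar_eq hd hv hB hBM]
  exact ⟨hB, hBM⟩

theorem bar_mem_classKbar {M : PreAbstractSimplicialComplex V} (hd : 2 * k + 2 ≤ d)
    (h : M ∈ classK V 𝓕 k d) : M.bar k ∈ classKbar V 𝓕 k (d + 1) := by
  have hlink : ∀ v ∈ (M.bar k).vertices,
      IsStackedBall 𝓕 k ((d : ℤ) + 1 - 1) ((M.bar k).link {v}) := by
    intro v hv
    rw [vertices_bar] at hv
    rw [add_sub_cancel_right]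
    exact (exists_ball_eq_link_bar hd h hv).1
  refine ⟨isFiniteOfDim_of_link (finite_bar h.1.1 k) ?_ fun v hv => (hlink v hv).isFiniteOfDim,
    hlink⟩
  rw [vertices_bar]
  exact nonempty_vertices (by omega) h.1

theorem bd_bar_eq {M : PreAbstractSimplicialComplex V} (hd : 2 * k + 2 ≤ d)
    (h : M ∈ classK V 𝓕 k d) : (M.bar k).bd = M := by
  have hV := vertices_bd_eq (by omega) (bar_mem_classKbar hd h).2
  rw [vertices_bar] at hV
  refine eq_of_link_vertex_eq hV fun v hv => ?_
  rw [← bd_link_vertex]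
  exact (exists_ball_eq_link_bar hd h (hV ▸ hv)).2

theorem isHomologyManifold_of_mem_classKbar {N : PreAbstractSimplicialComplex V} {m : ℤ}
    (h : N ∈ classKbar V 𝓕 k m) : IsHomologyManifold 𝓕 m N :=
  ⟨h.1, fun v hv => Or.inr (h.2 v hv).1⟩

/-- The uniqueness claim follows from this: any competing manifold lies in the class on which `bar`
inverts the boundary map. -/
theorem mem_classKbar_of_isHomologyManifold {N : PreAbstractSimplicialComplex V}
    (hd : 2 * k + 2 ≤ d) (hN : IsHomologyManifold 𝓕 (d + 1) N) (h : N.bd ∈ classK V 𝓕 k d)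
    (hskel : N.skel ((d : ℤ) - k) = N.bd.skel ((d : ℤ) - k)) :
    N ∈ classKbar V 𝓕 k (d + 1) := by
  have hiff := skel_eq_iff.1 hskel
  refine ⟨hN.1, fun v hv => ?_⟩
  have hvbd : v ∈ N.bd.vertices := mem_faces_of_mem_simplices
    ((hiff {v} (by simp only [Finset.card_singleton]; omega)).1 (Or.inr hv))
    (Finset.singleton_nonempty v)
  refine ⟨(hN.2 v hv).resolve_left ?_, ?_⟩
  -- A sphere has empty boundary, but the boundary of this link is a vertex link of `∂N`, of
  -- dimension `d - 1 ≥ 0`.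
  · rintro ⟨⟨F, _⟩, -, hS⟩
    obtain ⟨τ, hτ⟩ := exists_mem_faces_of_dim (by omega) (h.2 v hvbd).1.isFiniteOfDim
    rw [← bd_link_vertex] at hτ
    exact IsHomologySphereOver.notMem_bd hS τ hτ
  · refine skel_eq_iff.2 fun σ hc => ?_
    rw [bd_link_vertex, mem_link_vertex_simplices hv, mem_link_vertex_simplices hvbd]
    refine and_congr_right fun hvσ => ?_
    have h1 := hiff (insert v σ) (by rw [Finset.card_insert_of_notMem hvσ]; push_cast; omega)
    exact ⟨fun h => mem_faces_of_mem_simplices (h1.1 (Or.inr h)) (Finset.insert_nonempty _ _),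
      mem_faces_of_mem_bd⟩

end Stacked

end PreAbstractSimplicialComplex

/-! ### The main theorem -/

open PreAbstractSimplicialComplex in
theorem theorem9 {V : Type*} [LinearOrder V] (𝓕 : Set (Σ F : Type*, Field F))
    (k d : ℕ) (hd : 2 * k + 2 ≤ d) :
    (∀ M ∈ PreAbstractSimplicialComplex.classK V 𝓕 k d,
      (PreAbstractSimplicialComplex.IsHomologyManifold 𝓕 (d + 1) (M.bar k) ∧
        (M.bar k).bd = M ∧ (M.bar k).skel (d - k) = M.skel (d - k)) ∧
      ∀ N : PreAbstractSimplicialComplex V,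
        PreAbstractSimplicialComplex.IsHomologyManifold 𝓕 (d + 1) N →
        N.bd = M → N.skel (d - k) = M.skel (d - k) → N = M.bar k) ∧
    (Set.BijOn (PreAbstractSimplicialComplex.bar k)
        (PreAbstractSimplicialComplex.classK V 𝓕 k d)
        (PreAbstractSimplicialComplex.classKbar V 𝓕 k (d + 1)) ∧
      Set.InvOn PreAbstractSimplicialComplex.bd (PreAbstractSimplicialComplex.bar k)
        (PreAbstractSimplicialComplex.classK V 𝓕 k d)
        (PreAbstractSimplicialComplex.classKbar V 𝓕 k (d + 1))) ∧
    (Set.BijOn (PreAbstractSimplicialComplex.bar k)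
        {M ∈ PreAbstractSimplicialComplex.classK V 𝓕 k d | M.IsConnected}
        {N ∈ PreAbstractSimplicialComplex.classKbar V 𝓕 k (d + 1) | N.IsConnected} ∧
      Set.InvOn PreAbstractSimplicialComplex.bd (PreAbstractSimplicialComplex.bar k)
        {M ∈ PreAbstractSimplicialComplex.classK V 𝓕 k d | M.IsConnected}
        {N ∈ PreAbstractSimplicialComplex.classKbar V 𝓕 k (d + 1) | N.IsConnected}) := by
  have hinv : Set.InvOn bd (bar k) (classK V 𝓕 k d) (classKbar V 𝓕 k (d + 1)) :=
    ⟨fun M hM => bd_bar_eq hd hM, fun N hN => bar_bd_eq hd hN⟩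
  have hbar : Set.MapsTo (bar k) (classK V 𝓕 k d) (classKbar V 𝓕 k (d + 1)) :=
    fun M hM => bar_mem_classKbar hd hM
  have hbd : Set.MapsTo bd (classKbar V 𝓕 k (d + 1)) (classK V 𝓕 k d) :=
    fun N hN => bd_mem_classK hd hN
  have hskel : ∀ M ∈ classK V 𝓕 k d, (M.bar k).skel ((d : ℤ) - k) = M.skel ((d : ℤ) - k) := by
    intro M hM
    rw [skel_eq_skel_bd hd (hbar hM), bd_bar_eq hd hM]
  have hinv' : Set.InvOn bd (bar k) {M ∈ classK V 𝓕 k d | M.IsConnected}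
      {N ∈ classKbar V 𝓕 k (d + 1) | N.IsConnected} :=
    hinv.mono (fun _ h => h.1) fun _ h => h.1
  refine ⟨fun M hM => ⟨⟨isHomologyManifold_of_mem_classKbar (hbar hM), bd_bar_eq hd hM,
    hskel M hM⟩, ?_⟩, ⟨hinv.bijOn hbar hbd, hinv⟩, hinv'.bijOn ?_ ?_, hinv'⟩
  · rintro N hN rfl hsk
    exact (bar_bd_eq hd (mem_classKbar_of_isHomologyManifold hd hN hM hsk)).symm
  -- Connectedness depends only on vertices and edges, which lie in the common `(d - k)`-skeleton
  -- since `d - k ≥ 1`.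
  · exact fun M hM => ⟨hbar hM.1, (isConnected_congr (hskel M hM.1) (by omega)).2 hM.2⟩
  · exact fun N hN =>
      ⟨hbd hN.1, (isConnected_congr (skel_eq_skel_bd hd hN.1) (by omega)).1 hN.2⟩
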